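/- **Model.** A quantum circuit with read access to a classical memory acts on finitely many qubits. Each gate has a set $A$ of address qubits and a disjoint set $B$ of target qubits; the memory holds, for every address $a\in\{0,1\}^A$, a record $(U_{a,b})_{b\in B}$ of single-qubit unitaries, and the gate maps $|a\rangle\otimes|\varphi\rangle$ to $|a\rangle\otimes\big(\bigotimes_{b\in B}U_{a,b}\big)|\varphi\rangle$. (Arbitrary one-qubit gates, CNOT, and memory reads $|a\rangle|y\rangle\mapsto|a\rangle|y\oplus f(a)\rangle$ are special cases.) Such a gate takes time $|A|+|B|$, the number of qubits it touches, and the running time of a circuit is the sum over its gates. The layout of a circuit is the list of the pairs $(A,B)$ of its gates, without the memory contents. The memory may hold arbitrary data computed classically beforehand from the vector to be prepared; this preprocessing is not counted. For a nonzero vector $x=(x_0,\ldots,x_{m-1})\in\mathbb{C}^m$ let $\kappa(x)=\max_k|x_k|/\min_{k,\,x_k\ne0}|x_k|$, and let $|x\rangle=\frac1{\|x\|}\sum_{i=0}^{m-1}x_i|i\rangle$ with $\|\cdot\|$ the Euclidean norm, where $|i\rangle$ is the computational basis state of $n=\lceil\log_2 m\rceil$ qubits given by the binary expansion of $i$. **Theorem.**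 There is an absolute constant $C>0$ such that for every integer $m\ge2$ and every real $K\ge1$ there are a number $k$ of ancilla qubits and a layout on $n+k$ qubits, of running time at most $C\sqrt{1+\log_2K}\,\log_2 m$, with the following property: for every nonzero $x\in\mathbb{C}^m$ with $\kappa(x)\le K$ the memory can be filled so that the resulting circuit maps $|0\rangle^{\otimes n}|0\rangle^{\otimes k}$ exactly to $|x\rangle|0\rangle^{\otimes k}$. In particular (take $K=\kappa(x)$), the quantum state of $x$ can be prepared in time $O\big(\sqrt{1+\log\kappa(x)}\,\log m\big)$. -/

import Mathlib

noncomputable section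

namespace StatePrep

/-- State vectors (amplitude functions) of a system of qubits labelled by `W`: the computational
basis states are the assignments `W → Bool`. -/
abbrev QState (W : Type) : Type := (W → Bool) → ℂ

/-- The computational basis state `|z⟩`. -/
def ket {W : Type} [DecidableEq W] [Fintype W] (z : W → Bool) : QState W := Pi.single z 1

/-- An elementary operation with quantum read access to a classical memory.  It has a set of
address qubits and a disjoint set of target qubits.  The memory holds, at each address
`a : address → Bool`, a record consisting of one single-qubit unitary for each target qubit.
The gate maps `|a⟩ ⊗ |φ⟩` to `|a⟩ ⊗ (⨂ b, table a b) |φ⟩`.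

Arbitrary single-qubit gates (no address, one target), controlled single-qubit gates such as CNOT
(one address, one target), and the memory read `|a⟩|y⟩ ↦ |a⟩|y ⊕ f a⟩` (the record at `a`
consists of identities and bit flips) are special cases. -/
structure Gate (W : Type) where
  address : Finset W
  target : Finset W
  disjoint : Disjoint address target
  table : (address → Bool) → target → Matrix.unitaryGroup Bool ℂ

variable {W : Type}

/-- The wiring of a gate: its address qubits and its target qubits, without the memory contents. -/
def Gate.wires (g : Gate W) : Finset W × Finset W := (g.address, g.target)

/-- The matrix of a gate in the computational basis: the entry at row `z` and column `w` is zero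
unless `z` and `w` agree off the target qubits. -/
def Gate.toMatrix [DecidableEq W] [Fintype W] (g : Gate W) : Matrix (W → Bool) (W → Bool) ℂ :=
  Matrix.of fun z w =>
    if ∀ i, i ∉ g.target → z i = w i then
      ∏ b : g.target, (g.table (fun a => z a) b : Matrix Bool Bool ℂ) (z b) (w b)
    else 0

/-- Run a circuit, a list of gates applied from left to right, on a state. -/
def run [DecidableEq W] [Fintype W] (c : List (Gate W)) (ψ : QState W) : QState W :=
  c.foldl (fun φ g => g.toMatrix.mulVec φ) ψ

/-- The layout of a circuit: the wirings of its gates, in order, without the memory contents. -/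
def layout (c : List (Gate W)) : List (Finset W × Finset W) := c.map Gate.wires

/-- The running time of a layout.  A gate takes as many time steps as it touches qubits: the
number of address bits plus the number of entries of the record that is read. -/
def time (L : List (Finset W × Finset W)) : ℕ := (L.map fun p => p.1.card + p.2.card).sum

/-- The bit assignment for the index `i`: its binary digits (least significant first) on the `n`
data qubits, and zero on the `k` ancilla qubits. -/
def encode (n k i : ℕ) : Fin n ⊕ Fin k → Bool :=
  Sum.elim (fun b => i.testBit b) (fun _ => false)

/-- The state `|x⟩ ⊗ |0…0⟩`, where `|x⟩ = ‖x‖⁻¹ ∑ i, x i |i⟩` on `n` data qubits and there are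
`k` ancilla qubits. -/
def vectorState {m : ℕ} (x : EuclideanSpace ℂ (Fin m)) (n k : ℕ) : QState (Fin n ⊕ Fin k) :=
  ∑ i : Fin m, (x i / (‖x‖ : ℂ)) • ket (encode n k i)

/-- `κ(x) = max |x i| / min_{x i ≠ 0} |x i|`. -/
def kappa {m : ℕ} (x : EuclideanSpace ℂ (Fin m)) : ℝ :=
  (⨆ i, ‖x i‖) / (⨅ i : {i : Fin m // x i ≠ 0}, ‖x i‖)

end StatePrep

end

/-! A layout of time `O(log m)` prepares every vector, which suffices because the factor `√(1 + log₂
K)` is at least 1. Sort the basis strings by decreasing probability and let `j` be the binary length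
of the rank. Within one length the probabilities are at most the first one of the block; replacing
them by this bound gives masses of total at most 4, by Cauchy condensation (`exists_rank`). So the
target is dominated by a simple law: choose `j`, then a uniform rank below `2 ^ j`. The choice of
`j` costs a single gate on a product state: independent qubits `|0⟩ + a k |1⟩`, whose weight-one
part encodes `j` in one-hot form and keeps enough amplitude because `∑ (a k)²` is bounded. After the
string of that rank is read, a flag rotation corrects the amplitude (quantum rejection sampling),
and size and rank are erased by recomputing them from the string. Components with the wrong size
keep a nonzero ancilla. This yields `s * X z` on zero ancillas for a constant `s` (`exists_block`).
With `s = sin (π/18)`, two rounds of amplitude amplification triple the angle to `π/6` and then to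
`π/2`, so the result is exact (`exists_exact`). -/

noncomputable section

namespace StatePrep

open Matrix

/-! ### Gates and circuits as unitary matrices. -/

section Circuits

variable {W : Type} [DecidableEq W] [Fintype W]

/-- The assignment that agrees with `z` on `A` and is zero elsewhere. -/
def restrict (A : Finset W) (z : W → Bool) : W → Bool := fun i => if i ∈ A then z i else false

/-- The gate with address qubits `A` and target qubits `B` whose record at the address `a` has the
entry `T a b` for the target qubit `b`, where `a` is extended by zero. -/
def mkGate (A B : Finset W) (h : Disjoint A B) (T : (W → Bool) → W → unitaryGroup Bool ℂ) :
    Gate W where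
  address := A
  target := B
  disjoint := h
  table a b := T (fun i => if h : i ∈ A then a ⟨i, h⟩ else false) b

/-- The single-qubit unitary that a gate applies to each qubit, given the values `z`. -/
def Gate.factor (g : Gate W) (z : W → Bool) (i : W) : unitaryGroup Bool ℂ :=
  if h : i ∈ g.target then g.table (fun a => z a) ⟨i, h⟩ else 1

omit [Fintype W] in
lemma mkGate_factor (A B : Finset W) (h : Disjoint A B)
    (T : (W → Bool) → W → unitaryGroup Bool ℂ) (z : W → Bool) (i : W) :
    (mkGate A B h T).factor z i = if i ∈ B then T (restrict A z) i else 1 := by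
  unfold Gate.factor mkGate restrict
  simp only [dite_eq_ite]

lemma Gate.toMatrix_apply (g : Gate W) (z w : W → Bool) :
    g.toMatrix z w = ∏ i, (g.factor z i : Matrix Bool Bool ℂ) (z i) (w i) := by
  rw [Gate.toMatrix, Matrix.of_apply, ← Finset.prod_mul_prod_compl g.target]
  have h1 : ∏ i ∈ g.target, (g.factor z i : Matrix Bool Bool ℂ) (z i) (w i) =
      ∏ b : g.target, (g.table (fun a => z a) b : Matrix Bool Bool ℂ) (z b) (w b) := by
    rw [← Finset.prod_coe_sort]
    refine Finset.prod_congr rfl fun b _ => ?_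
    simp [Gate.factor]
  have h2 : ∏ i ∈ g.targetᶜ, (g.factor z i : Matrix Bool Bool ℂ) (z i) (w i) =
      if ∀ i, i ∉ g.target → z i = w i then 1 else 0 := by
    have : ∀ i ∈ g.targetᶜ, (g.factor z i : Matrix Bool Bool ℂ) (z i) (w i) =
        if z i = w i then 1 else 0 := by
      intro i hi
      rw [Finset.mem_compl] at hi
      simp [Gate.factor, hi, Matrix.one_apply]
    rw [Finset.prod_congr rfl this]
    split_ifs with h
    · exact Finset.prod_eq_one fun i hi => if_pos (h i (by simpa using hi))
    · push Not at h
      obtain ⟨i, hi, hne⟩ := h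
      exact Finset.prod_eq_zero (i := i) (by simpa using hi) (if_neg hne)
  rw [h1, h2]
  split_ifs <;> simp

lemma Gate.toMatrix_eq_zero (g : Gate W) {z w : W → Bool} {i : W} (hi : i ∉ g.target)
    (h : z i ≠ w i) : g.toMatrix z w = 0 := by
  rw [Gate.toMatrix, Matrix.of_apply, if_neg fun H => h (H i hi)]

omit [DecidableEq W] [Fintype W] in
lemma Gate.table_congr (g : Gate W) {z w : W → Bool} (h : ∀ i ∈ g.address, z i = w i) :
    (g.table fun a => z a) = g.table fun a => w a := by
  congr 1
  funext a
  exact h a a.2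

/-- Gates are unitary. -/
lemma Gate.toMatrix_mul_conjTranspose (g : Gate W) : g.toMatrix * g.toMatrixᴴ = 1 := by
  ext z z'
  have key : (g.toMatrix * g.toMatrixᴴ) z z' =
      ∏ i, ((g.factor z i : Matrix Bool Bool ℂ) * (g.factor z' i : Matrix Bool Bool ℂ)ᴴ)
        (z i) (z' i) := by
    simp only [Matrix.mul_apply, Matrix.conjTranspose_apply, Gate.toMatrix_apply, star_prod,
      ← Finset.prod_mul_distrib]
    rw [Finset.prod_univ_sum, Fintype.piFinset_univ]
  rw [key, Matrix.one_apply]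
  -- Equal addresses select the same record, and unitarity holds qubit by qubit; at an address bit
  -- that differs both factors are the identity, so the product vanishes.
  by_cases h : ∀ i ∈ g.address, z i = z' i
  · have hl : ∀ i, g.factor z' i = g.factor z i := by
      intro i
      simp only [Gate.factor, g.table_congr h]
    have hu : ∀ i, (g.factor z i : Matrix Bool Bool ℂ) * (g.factor z i : Matrix Bool Bool ℂ)ᴴ = 1 :=
      fun i => mem_unitaryGroup_iff.1 (g.factor z i).2
    simp only [hl, hu, Matrix.one_apply]
    split_ifs with hz
    · subst hz; simp
    · obtain ⟨i, hi⟩ := Function.ne_iff.1 hz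
      exact Finset.prod_eq_zero (Finset.mem_univ i) (if_neg hi)
  · push Not at h
    obtain ⟨i, hi, hne⟩ := h
    have ht : i ∉ g.target := Finset.disjoint_left.1 g.disjoint hi
    rw [if_neg fun H => hne (congrFun H i)]
    refine Finset.prod_eq_zero (Finset.mem_univ i) ?_
    simp [Gate.factor, ht, hne]

/-- The inverse of a gate. -/
def Gate.inv (g : Gate W) : Gate W where
  address := g.address
  target := g.target
  disjoint := g.disjoint
  table a b := star (g.table a b)

/-- Address qubits are not targets, so they keep their values and the record can be inverted address
by address. -/
lemma Gate.inv_toMatrix (g : Gate W) : g.inv.toMatrix = g.toMatrixᴴ := by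
  ext z w
  rw [Matrix.conjTranspose_apply]
  by_cases h : ∀ i, i ∉ g.target → z i = w i
  · have hl : ∀ i, g.inv.factor z i = star (g.factor w i) := by
      intro i
      by_cases hi : i ∈ g.target
      · simp only [Gate.factor, Gate.inv, hi, dite_true]
        rw [g.table_congr fun i hi => h i (Finset.disjoint_left.1 g.disjoint hi)]
        exact dif_pos hi
      · simp [Gate.factor, Gate.inv, hi]
    rw [Gate.toMatrix_apply, Gate.toMatrix_apply, star_prod]
    refine Finset.prod_congr rfl fun i _ => ?_
    rw [hl]
    simp [Matrix.star_apply]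
  · push Not at h
    obtain ⟨i, hi, hne⟩ := h
    have h0 : g.inv.toMatrix z w = 0 := g.inv.toMatrix_eq_zero (i := i) hi hne
    rw [h0, g.toMatrix_eq_zero hi hne.symm, star_zero]

lemma run_append (c d : List (Gate W)) (ψ : QState W) : run (c ++ d) ψ = run d (run c ψ) := by
  simp [run]

lemma run_cons (g : Gate W) (c : List (Gate W)) (ψ : QState W) :
    run (g :: c) ψ = run c (g.toMatrix.mulVec ψ) := rfl

@[simp] lemma run_nil (ψ : QState W) : run [] ψ = ψ := rfl

/-- The inverse of a circuit. -/
def circuitInv (c : List (Gate W)) : List (Gate W) := (c.map Gate.inv).reverse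

/-- The matrix of a circuit. -/
def circuitMatrix (c : List (Gate W)) : Matrix (W → Bool) (W → Bool) ℂ :=
  (c.map Gate.toMatrix).reverse.prod

lemma run_eq_mulVec (c : List (Gate W)) (ψ : QState W) : run c ψ = circuitMatrix c *ᵥ ψ := by
  induction c generalizing ψ with
  | nil => simp [circuitMatrix]
  | cons g c ih =>
    rw [run_cons, ih]
    simp [circuitMatrix, Matrix.mulVec_mulVec]

lemma circuitMatrix_mul_conjTranspose (c : List (Gate W)) :
    circuitMatrix c * (circuitMatrix c)ᴴ = 1 := by
  induction c with
  | nil => simp [circuitMatrix]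
  | cons g c ih =>
    have : circuitMatrix (g :: c) = circuitMatrix c * g.toMatrix := by simp [circuitMatrix]
    rw [this, Matrix.conjTranspose_mul, Matrix.mul_assoc, ← Matrix.mul_assoc g.toMatrix,
      g.toMatrix_mul_conjTranspose, Matrix.one_mul, ih]

lemma circuitMatrix_inv (c : List (Gate W)) :
    circuitMatrix (circuitInv c) = (circuitMatrix c)ᴴ := by
  induction c with
  | nil => simp [circuitMatrix, circuitInv]
  | cons g c ih =>
    have h1 : circuitMatrix (g :: c) = circuitMatrix c * g.toMatrix := by simp [circuitMatrix]
    have h2 : circuitMatrix (circuitInv (g :: c)) =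
        g.inv.toMatrix * circuitMatrix (circuitInv c) := by
      simp [circuitMatrix, circuitInv]
    rw [h1, h2, ih, Matrix.conjTranspose_mul, g.inv_toMatrix]

lemma norm_sq_run (c : List (Gate W)) (ψ : QState W) :
    star (run c ψ) ⬝ᵥ run c ψ = star ψ ⬝ᵥ ψ := by
  rw [run_eq_mulVec, Matrix.star_mulVec, Matrix.dotProduct_mulVec, Matrix.vecMul_vecMul,
    mul_eq_one_comm.1 (circuitMatrix_mul_conjTranspose c), Matrix.vecMul_one]

omit [DecidableEq W] [Fintype W] in
lemma layout_append (c d : List (Gate W)) : layout (c ++ d) = layout c ++ layout d := by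
  simp [layout]

omit [DecidableEq W] [Fintype W] in
lemma layout_circuitInv (c : List (Gate W)) : layout (circuitInv c) = (layout c).reverse := by
  simp [layout, circuitInv, List.map_reverse, Function.comp_def, Gate.wires, Gate.inv]

omit [DecidableEq W] [Fintype W] in
lemma time_append (L M : List (Finset W × Finset W)) : time (L ++ M) = time L + time M := by
  simp [time]

omit [DecidableEq W] [Fintype W] in
lemma time_reverse (L : List (Finset W × Finset W)) : time L.reverse = time L := by
  simp [time, List.map_reverse, List.sum_reverse]

/-! ### Amplitude amplification. -/

/-- The diagonal single-qubit unitary with signs `σ`. -/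
def signUnitary (σ : Bool → Bool) : unitaryGroup Bool ℂ :=
  ⟨Matrix.diagonal fun b => if σ b then -1 else 1, by
    rw [mem_unitaryGroup_iff, Matrix.star_eq_conjTranspose, Matrix.diagonal_conjTranspose,
      Matrix.diagonal_mul_diagonal, ← Matrix.diagonal_one]
    congr 1
    funext b
    by_cases h : σ b <;> simp [h]⟩

/-- The gate that flips the sign of the basis states `z` with `σ z`. -/
def signGate (q : W) (σ : (W → Bool) → Bool) : Gate W :=
  mkGate (Finset.univ.erase q) {q} (by simp)
    fun a _ => signUnitary fun b => σ (Function.update a q b)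

lemma signGate_mulVec (q : W) (σ : (W → Bool) → Bool) (ψ : QState W) (z : W → Bool) :
    ((signGate q σ).toMatrix *ᵥ ψ) z = (if σ z then -1 else 1) * ψ z := by
  -- All qubits but `q` are addressed, so the record together with the value of `q` determines the
  -- whole string.
  have hz : Function.update (restrict (Finset.univ.erase q) z) q (z q) = z := by
    funext i
    by_cases h : i = q
    · subst h; simp
    · simp [h, restrict]
  rw [Matrix.mulVec, dotProduct, Finset.sum_eq_single z]
  · congr 1
    rw [Gate.toMatrix_apply, Finset.prod_eq_single q]
    · simp [signGate, mkGate_factor, signUnitary, hz]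
    · intro i _ hi
      simp [signGate, mkGate_factor, hi]
    · simp
  · intro w _ hw
    obtain ⟨i, hi⟩ := Function.ne_iff.1 hw
    rw [Gate.toMatrix_apply, Finset.prod_eq_zero (Finset.mem_univ i), zero_mul]
    by_cases h : i = q
    · subst h; simp [signGate, mkGate_factor, signUnitary, hi.symm]
    · simp [signGate, mkGate_factor, h, hi.symm]
  · simp

/-- One round of amplitude amplification towards the basis states satisfying `P`. -/
def amplify (q : W) (P : (W → Bool) → Bool) (c : List (Gate W)) : List (Gate W) :=
  c ++ [signGate q P] ++ circuitInv c ++ [signGate q fun z => decide (z ≠ fun _ => false)] ++ c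

lemma star_dotProduct_ket (z : W → Bool) : star (ket z) ⬝ᵥ ket z = 1 := by
  simp [ket]

/-- The two sign flips are reflections in the plane of the good and bad parts of `u`. With `s = sin
θ` the good amplitude becomes `(3 - 4 * s ^ 2) * s = sin 3θ`. -/
lemma run_amplify (q : W) (P : (W → Bool) → Bool) (c : List (Gate W)) (s : ℝ)
    (hs : ∑ z with P z, ‖run c (ket fun _ => false) z‖ ^ 2 = s ^ 2) (z : W → Bool) :
    run (amplify q P c) (ket fun _ => false) z =
      (if P z then (3 - 4 * s ^ 2 : ℂ) else 1 - 4 * s ^ 2) * run c (ket fun _ => false) z := by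
  set u := run c (ket fun _ => false) with hu
  set v : QState W := (signGate q P).toMatrix *ᵥ u with hv
  set φ : QState W := (circuitMatrix c)ᴴ *ᵥ v with hφ
  set o : W → Bool := fun _ => false with ho
  have hnorm : star u ⬝ᵥ u = 1 := by rw [hu, norm_sq_run, star_dotProduct_ket]
  have hnorm' : ∑ z, (‖u z‖ : ℂ) ^ 2 = 1 := by
    rw [← hnorm, dotProduct]
    refine Finset.sum_congr rfl fun z _ => ?_
    rw [Pi.star_apply, Complex.star_def, Complex.conj_mul']
  have hφ0 : φ o = 1 - 2 * s ^ 2 := by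
    have h1 : φ o = star u ⬝ᵥ v := by
      rw [hu, run_eq_mulVec, Matrix.star_mulVec, ← Matrix.dotProduct_mulVec, ← hφ]
      simp [ket]
    have h2 : star u ⬝ᵥ v = ∑ z, ((‖u z‖ : ℂ) ^ 2 - if P z then 2 * (‖u z‖ : ℂ) ^ 2 else 0) := by
      rw [dotProduct]
      refine Finset.sum_congr rfl fun z _ => ?_
      rw [hv, signGate_mulVec, Pi.star_apply, Complex.star_def, mul_left_comm, Complex.conj_mul']
      split_ifs <;> ring
    rw [h1, h2, Finset.sum_sub_distrib, hnorm', ← Finset.sum_filter, ← Finset.mul_sum]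
    congr 2
    exact_mod_cast hs
  -- Flipping every basis state except `o` is the reflection `2|o⟩⟨o| - 1`; conjugating it by the
  -- circuit gives the reflection about `u`.
  have hr : (signGate q fun z => decide (z ≠ o)).toMatrix *ᵥ φ = (2 * φ o) • ket o - φ := by
    funext z
    rw [signGate_mulVec]
    by_cases h : z = o
    · subst h; simp [ket]; ring
    · simp [ket, h]
  have hback : circuitMatrix c *ᵥ φ = v := by
    rw [hφ, Matrix.mulVec_mulVec, circuitMatrix_mul_conjTranspose, Matrix.one_mulVec]
  have hrun : run (amplify q P c) (ket o) = (2 * φ o) • u - v := by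
    rw [amplify, run_append, run_append, run_append, run_append, run_cons, run_nil, run_cons,
      run_nil, run_eq_mulVec (circuitInv c), circuitMatrix_inv, ← hu, ← hv, ← hφ, hr,
      run_eq_mulVec c, Matrix.mulVec_sub, Matrix.mulVec_smul, ← run_eq_mulVec, ← hu, hback]
  rw [hrun, Pi.sub_apply, Pi.smul_apply, hφ0, hv, signGate_mulVec, smul_eq_mul]
  split_ifs <;> ring

/-- The layout of `amplify`. -/
def amplifyLayout (q : W) (L : List (Finset W × Finset W)) : List (Finset W × Finset W) :=
  L ++ [(Finset.univ.erase q, {q})] ++ L.reverse ++ [(Finset.univ.erase q, {q})] ++ L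

lemma layout_amplify (q : W) (P : (W → Bool) → Bool) (c : List (Gate W)) :
    layout (amplify q P c) = amplifyLayout q (layout c) := by
  simp only [amplify, amplifyLayout, layout_append, layout_circuitInv]
  simp [layout, Gate.wires, signGate, mkGate]

lemma time_amplifyLayout (q : W) (L : List (Finset W × Finset W)) :
    time (amplifyLayout q L) = 3 * time L + 2 * Fintype.card W := by
  have h : time [((Finset.univ.erase q, {q}) : Finset W × Finset W)] = Fintype.card W := by
    have := Fintype.card_pos_iff.2 ⟨q⟩
    simp [time]
    omega
  simp only [amplifyLayout, time_append, time_reverse, h]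
  ring

/-! ### Gates acting on zero qubits, bit flips, and single-qubit unitaries. -/

/-- The qubit `i` is in the state `|0⟩`. -/
def IsZeroAt (i : W) (ψ : QState W) : Prop := ∀ w, w i = true → ψ w = 0

lemma isZeroAt_ket (i : W) : IsZeroAt i (ket fun _ => false) := by
  intro w hw
  refine Pi.single_eq_of_ne (fun h => ?_) _
  simp [h] at hw

lemma IsZeroAt.mulVec {i : W} {ψ : QState W} (hψ : IsZeroAt i ψ) (g : Gate W)
    (hi : i ∉ g.target) : IsZeroAt i (g.toMatrix *ᵥ ψ) := by
  intro z hz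
  refine Finset.sum_eq_zero fun w _ => ?_
  change g.toMatrix z w * ψ w = 0
  by_cases h : w i = true
  · rw [hψ w h, mul_zero]
  · rw [g.toMatrix_eq_zero hi (fun H => h (H.symm.trans hz)), zero_mul]

/-- The action of a gate whose target qubits are in the state `|0⟩`. -/
lemma Gate.mulVec_of_isZeroAt (g : Gate W) (ψ : QState W) (h : ∀ i ∈ g.target, IsZeroAt i ψ)
    (z : W → Bool) :
    (g.toMatrix *ᵥ ψ) z = (∏ i ∈ g.target, (g.factor z i : Matrix Bool Bool ℂ) (z i) false) *
      ψ (fun i => if i ∈ g.target then false else z i) := by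
  rw [Matrix.mulVec, dotProduct,
    Finset.sum_eq_single (fun i => if i ∈ g.target then false else z i)]
  · congr 1
    rw [Gate.toMatrix_apply, ← Finset.prod_mul_prod_compl g.target,
      Finset.prod_eq_one (s := g.targetᶜ), mul_one]
    · exact Finset.prod_congr rfl fun i hi => by rw [if_pos hi]
    · intro i hi
      rw [Finset.mem_compl] at hi
      simp [Gate.factor, hi]
  · intro w _ hw
    obtain ⟨i, hi⟩ := Function.ne_iff.1 hw
    by_cases ht : i ∈ g.target
    · rw [if_pos ht, ne_eq, Bool.not_eq_false] at hi
      rw [h i ht w hi, mul_zero]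
    · rw [if_neg ht] at hi
      rw [g.toMatrix_eq_zero ht hi.symm, zero_mul]
  · simp

/-- The identity or the bit flip. -/
def flipUnitary (c : Bool) : unitaryGroup Bool ℂ :=
  ⟨Matrix.of fun a b => if a = (b ^^ c) then 1 else 0, by
    rw [mem_unitaryGroup_iff]
    ext a b
    cases a <;> cases b <;> cases c <;> simp [Matrix.mul_apply]⟩

lemma flipUnitary_apply (c a b : Bool) :
    (flipUnitary c : Matrix Bool Bool ℂ) a b = if a = (b ^^ c) then 1 else 0 := rfl

lemma flipUnitary_false : flipUnitary false = 1 := by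
  ext a b
  simp [flipUnitary_apply, Matrix.one_apply]

/-- The action of a gate that flips target qubits. -/
lemma Gate.mulVec_of_factor_eq_flip (g : Gate W) (ψ : QState W) (z c : W → Bool)
    (h : ∀ i, g.factor z i = flipUnitary (c i)) :
    (g.toMatrix *ᵥ ψ) z = ψ fun i => z i ^^ c i := by
  rw [Matrix.mulVec, dotProduct, Finset.sum_eq_single fun i => z i ^^ c i]
  · rw [Gate.toMatrix_apply, Finset.prod_eq_one, one_mul]
    intro i _
    rw [h, flipUnitary_apply, if_pos (by simp)]
  · intro w _ hw
    obtain ⟨i, hi⟩ := Function.ne_iff.1 hw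
    rw [Gate.toMatrix_apply, Finset.prod_eq_zero (Finset.mem_univ i), zero_mul]
    rw [h, flipUnitary_apply, if_neg]
    intro H
    apply hi
    rw [H]
    simp
  · simp

/-- The unitary with prescribed first column. -/
lemma exists_unitary_column (a b : ℂ) (h : ‖a‖ ^ 2 + ‖b‖ ^ 2 = 1) :
    ∃ U : unitaryGroup Bool ℂ, (U : Matrix Bool Bool ℂ) false false = a ∧
      (U : Matrix Bool Bool ℂ) true false = b := by
  have h' : a * (starRingEnd ℂ) a + b * (starRingEnd ℂ) b = 1 := by
    rw [Complex.mul_conj', Complex.mul_conj']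
    exact_mod_cast h
  refine ⟨⟨Matrix.of fun i j => if i then (if j then star a else b) else
    (if j then -star b else a), ?_⟩, by simp, by simp⟩
  rw [mem_unitaryGroup_iff]
  ext i j
  cases i <;> cases j <;> simp [Matrix.mul_apply] <;>
    first | ring1 | linear_combination h'

lemma exists_unitary_corner (a : ℂ) (h : ‖a‖ ≤ 1) :
    ∃ U : unitaryGroup Bool ℂ, (U : Matrix Bool Bool ℂ) false false = a := by
  obtain ⟨U, hU, -⟩ := exists_unitary_column a (Real.sqrt (1 - ‖a‖ ^ 2) : ℝ) (by
    rw [Complex.norm_real, Real.norm_eq_abs, sq_abs, Real.sq_sqrt]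
    · ring
    · nlinarith [norm_nonneg a])
  exact ⟨U, hU⟩

end Circuits

/-! ### Dyadic domination of a sorted distribution. -/

/-- Ranking of a probability distribution by decreasing probability: the total mass of the
distribution that is, on each dyadic block of ranks, constant and at least the given one is
bounded. -/
lemma exists_rank {n : ℕ} {ι : Type} [Fintype ι] (hι : Fintype.card ι = 2 ^ n) (p : ι → ℝ)
    (hp : ∀ z, 0 ≤ p z) (hsum : ∑ z, p z = 1) :
    ∃ (g : ι → ℕ) (t : ℕ → ℝ), Function.Injective g ∧ (∀ z, g z < 2 ^ n) ∧ (∀ j, 0 ≤ t j) ∧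
      ∑ j ∈ Finset.range (n + 1), t j ≤ 4 ∧
      ∀ z, 2 ^ (g z).size * p z ≤ t (g z).size := by
  classical
  let e : ι ≃ Fin (2 ^ n) := Fintype.equivFinOfCardEq hι
  let σ : Equiv.Perm (Fin (2 ^ n)) := Tuple.sort fun i => -p (e.symm i)
  have hσ : ∀ i j, i ≤ j → p (e.symm (σ j)) ≤ p (e.symm (σ i)) := fun i j hij =>
    neg_le_neg_iff.1 (Tuple.monotone_sort (fun i => -p (e.symm i)) hij)
  let q : ℕ → ℝ := fun r => if h : r < 2 ^ n then p (e.symm (σ ⟨r, h⟩)) else 0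
  have hq0 : ∀ r, 0 ≤ q r := by
    intro r
    simp only [q]
    split_ifs
    · exact hp _
    · exact le_rfl
  have hqa : ∀ ⦃r s⦄, r ≤ s → q s ≤ q r := by
    intro r s hrs
    by_cases hs : s < 2 ^ n
    · have hr := hrs.trans_lt hs
      simp only [q, hs, hr, dite_true]
      exact hσ _ _ hrs
    · simpa only [q, hs, dite_false] using hq0 r
  have hqs : ∑ r ∈ Finset.range (2 ^ n), q r = 1 := by
    rw [Finset.sum_range, ← hsum, ← (σ.trans e.symm).sum_comp]
    exact Finset.sum_congr rfl fun i _ => by simp [q]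
  -- Ranks of size `i + 1` start at `2 ^ i`, where `q` is largest on the block; size 0 is the rank 0
  -- alone.
  let t : ℕ → ℝ := fun j => Nat.casesOn j (q 0) fun i => 2 ^ (i + 1) * q (2 ^ i)
  refine ⟨fun z => (σ.symm (e z)).val, t, ?_, fun z => (σ.symm (e z)).2, ?_, ?_, ?_⟩
  · exact fun x y h => e.injective (σ.symm.injective (Fin.ext h))
  · rintro (_ | j)
    · exact hq0 _
    · exact mul_nonneg (by positivity) (hq0 _)
  · rw [Finset.sum_range_succ']
    change ∑ i ∈ Finset.range n, 2 ^ (i + 1) * q (2 ^ i) + q 0 ≤ 4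
    rcases n with _ | k
    · simp at hqs ⊢
      linarith
    -- Condensation bounds the sum by `q 0 + 2 * (q 1 + 2 * S)`, at most four times the total mass,
    -- with `S` the sum of `q` from 2 to `2 ^ k`.
    · have h1 := Finset.sum_condensed_le (f := q) (fun _ _ _ hmn => hqa hmn) k
      have h2 : ∑ i ∈ Finset.range (k + 1), 2 ^ (i + 1) * q (2 ^ i) =
          2 * ∑ i ∈ Finset.range (k + 1), 2 ^ i • q (2 ^ i) := by
        rw [Finset.mul_sum]
        refine Finset.sum_congr rfl fun i _ => ?_
        rw [nsmul_eq_mul]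
        push_cast
        ring
      have h3 : q 0 + (q 1 + ∑ r ∈ Finset.Ico 2 (2 ^ k + 1), q r) ≤
          ∑ r ∈ Finset.range (2 ^ (k + 1)), q r := by
        have hk := Nat.one_le_two_pow (n := k)
        have : q 0 + (q 1 + ∑ r ∈ Finset.Ico 2 (2 ^ k + 1), q r) =
            ∑ r ∈ Finset.range (2 ^ k + 1), q r := by
          rw [Finset.range_eq_Ico, Finset.sum_eq_sum_Ico_succ_bot (a := 0) (by omega),
            Finset.sum_eq_sum_Ico_succ_bot (a := 0 + 1) (by omega)]
        rw [this]
        refine Finset.sum_le_sum_of_subset_of_nonneg ?_ fun i _ _ => hq0 i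
        intro r
        simp only [Finset.mem_range]
        rw [pow_succ]
        omega
      rw [hqs] at h3
      rw [h2]
      rw [nsmul_eq_mul] at h1
      push_cast at h1
      linarith [hq0 0, hq0 1]
  · intro z
    have hz : q (σ.symm (e z)).val = p z := by simp [q]
    change 2 ^ (σ.symm (e z)).val.size * p z ≤ t (σ.symm (e z)).val.size
    rw [← hz]
    generalize (σ.symm (e z)).val = r
    rcases hs : r.size with _ | j
    · rw [Nat.size_eq_zero.1 hs]
      simp [t]
    · have : 2 ^ j ≤ r := Nat.lt_size.1 (by omega)
      exact mul_le_mul_of_nonneg_left (hqa this) (by positivity)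

/-! ### The block circuit: preparation with constant amplitude. -/

/-- The ancilla qubits: the size of the rank in one-hot encoding, the rank, and a flag. -/
abbrev Ancilla (n : ℕ) : Type := Fin (n + 1) ⊕ Fin n ⊕ Unit

/-- The data qubits and the ancilla qubits. -/
abbrev Register (n : ℕ) : Type := Fin n ⊕ Ancilla n

/-- The data qubits. -/
abbrev dataQubits (n : ℕ) : Finset (Register n) := Finset.univ.disjSum ∅

/-- The qubits of the one-hot encoded size. -/
abbrev sizeQubits (n : ℕ) : Finset (Register n) :=
  (∅ : Finset (Fin n)).disjSum (Finset.univ.disjSum ∅)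

/-- The qubits of the rank. -/
abbrev rankQubits (n : ℕ) : Finset (Register n) :=
  (∅ : Finset (Fin n)).disjSum ((∅ : Finset (Fin (n + 1))).disjSum (Finset.univ.disjSum ∅))

/-- The flag. -/
abbrev flagQubit (n : ℕ) : Finset (Register n) :=
  (∅ : Finset (Fin n)).disjSum ((∅ : Finset (Fin (n + 1))).disjSum
    ((∅ : Finset (Fin n)).disjSum Finset.univ))

/-- The qubits of the size and of the rank. -/
abbrev indexQubits (n : ℕ) : Finset (Register n) :=
  (∅ : Finset (Fin n)).disjSum (Finset.univ.disjSum (Finset.univ.disjSum ∅))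

/-- The layout of the circuit that prepares a vector up to a constant amplitude. -/
def blockLayout (n : ℕ) : List (Finset (Register n) × Finset (Register n)) :=
  [(∅, sizeQubits n), (sizeQubits n, rankQubits n), (rankQubits n, dataQubits n),
    (dataQubits n, flagQubit n), (dataQubits n, indexQubits n)]

lemma time_blockLayout (n : ℕ) : time (blockLayout n) = 9 * n + 4 := by
  simp [time, blockLayout]
  ring

/-- Prepare the size register in a product state. -/
def sizeGate {n : ℕ} (U : Fin (n + 1) → unitaryGroup Bool ℂ) : Gate (Register n) :=
  mkGate ∅ (sizeQubits n) (by simp)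
    fun _ i => Sum.elim (fun _ => 1) (Sum.elim U fun _ => 1) i

/-- Apply `H` to the lowest `j` qubits of the rank, where `j` is the value of the size register. -/
def rankGate (n : ℕ) (H : unitaryGroup Bool ℂ) : Gate (Register n) :=
  mkGate (sizeQubits n) (rankQubits n) (by simp [Finset.disjoint_left])
    fun a i => Sum.elim (fun _ => 1) (Sum.elim (fun _ => 1) (Sum.elim
      (fun l : Fin n => if ∃ k : Fin (n + 1), l.1 < k.1 ∧ a (Sum.inr (Sum.inl k)) = true
        then H else 1) fun _ => 1)) i

/-- Read the data string at a given rank. -/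
def dataGate {n : ℕ} (f : (Fin n → Bool) → Fin n → Bool) : Gate (Register n) :=
  mkGate (rankQubits n) (dataQubits n) (by simp [Finset.disjoint_left])
    fun a i => Sum.elim
      (fun l => flipUnitary (f (fun l => a (Sum.inr (Sum.inr (Sum.inl l)))) l)) (fun _ => 1) i

/-- Rotate the flag depending on the data string. -/
def flagGate {n : ℕ} (U : (Fin n → Bool) → unitaryGroup Bool ℂ) : Gate (Register n) :=
  mkGate (dataQubits n) (flagQubit n) (by simp [Finset.disjoint_left])
    fun a _ => U fun l => a (Sum.inl l)

/-- Read the size and the rank of a data string. -/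
def indexGate {n : ℕ} (g : (Fin n → Bool) → Ancilla n → Bool) : Gate (Register n) :=
  mkGate (dataQubits n) (indexQubits n) (by simp [Finset.disjoint_left])
    fun a i => flipUnitary (Sum.elim (fun _ => false) (g fun l => a (Sum.inl l)) i)

/-- The size, the rank and the flag for the rank `r`. -/
def indexBits (n r : ℕ) : Ancilla n → Bool :=
  Sum.elim (fun k => decide (k.1 = r.size)) (Sum.elim (fun l => r.testBit l) fun _ => false)

/-- Only one computational path ends at `z` with zero ancillas: the one with the one-hot size and
the rank of `z`. The amplitude is the product of the gate entries along it. -/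
lemma run_block {n : ℕ} (T : Fin (n + 1) → unitaryGroup Bool ℂ) (H : unitaryGroup Bool ℂ)
    (f : (Fin n → Bool) → Fin n → Bool) (V : (Fin n → Bool) → unitaryGroup Bool ℂ)
    (g : (Fin n → Bool) → ℕ) (z : Fin n → Bool) (hg : g z < 2 ^ n)
    (hf : f (fun l => (g z).testBit l) = z) :
    run [sizeGate T, rankGate n H, dataGate f, flagGate V, indexGate fun z => indexBits n (g z)]
      (ket fun _ => false) (Sum.elim z fun _ => false) =
    (V z : Matrix Bool Bool ℂ) false false *
      ((∏ l : Fin n, if l.1 < (g z).size then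
        (H : Matrix Bool Bool ℂ) ((g z).testBit l) false else 1) *
      ∏ k : Fin (n + 1), (T k : Matrix Bool Bool ℂ) (decide (k.1 = (g z).size)) false) := by
  set r := g z with hr
  have hsize : r.size < n + 1 := Nat.lt_succ_of_le (Nat.size_le.2 hg)
  simp only [run_cons, run_nil]
  set ψ₀ : QState (Register n) := ket fun _ => false
  have h0 : ∀ i, IsZeroAt i ψ₀ := fun i => isZeroAt_ket i
  set ψ₁ := (sizeGate T).toMatrix *ᵥ ψ₀ with hψ₁
  have h1 : ∀ i, i ∉ sizeQubits n → IsZeroAt i ψ₁ := fun i hi => (h0 i).mulVec _ hi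
  set ψ₂ := (rankGate n H).toMatrix *ᵥ ψ₁ with hψ₂
  have h2 : ∀ i, i ∉ sizeQubits n → i ∉ rankQubits n → IsZeroAt i ψ₂ :=
    fun i hi hi' => (h1 i hi).mulVec _ hi'
  set ψ₃ := (dataGate f).toMatrix *ᵥ ψ₂ with hψ₃
  have h3 : ∀ i ∈ flagQubit n, IsZeroAt i ψ₃ := by
    intro i hi
    refine (h2 i ?_ ?_).mulVec _ ?_ <;> revert hi <;>
      rcases i with _ | _ | _ | _ <;> simp [dataGate, mkGate]
  have e1 : ψ₁ (Sum.elim (fun _ => false) (Sum.elim (fun k => decide (k.1 = r.size))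
      fun _ => false)) =
      ∏ k : Fin (n + 1), (T k : Matrix Bool Bool ℂ) (decide (k.1 = r.size)) false := by
    rw [hψ₁, Gate.mulVec_of_isZeroAt _ _ fun i _ => h0 i]
    have : (fun i => if i ∈ (sizeGate T).target then false else
        (Sum.elim (fun _ => false) (Sum.elim (fun k => decide (k.1 = r.size))
          fun _ => false) : Register n → Bool) i) = fun _ => false := by
      funext i
      rcases i with _ | _ | _ <;> simp [sizeGate, mkGate]
    rw [this]
    simp only [sizeGate, mkGate_factor]
    simp [mkGate, ψ₀, ket]
  have e2 : ψ₂ (Sum.elim (fun _ => false) (indexBits n r)) =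
      (∏ l : Fin n, if l.1 < r.size then
        (H : Matrix Bool Bool ℂ) (r.testBit l) false else 1) *
      ∏ k : Fin (n + 1), (T k : Matrix Bool Bool ℂ) (decide (k.1 = r.size)) false := by
    rw [hψ₂, Gate.mulVec_of_isZeroAt _ _ fun i hi => h1 i ?_, ← e1]
    · congr 1
      · have hex : ∀ l : Fin n, (∃ k : Fin (n + 1), l.1 < k.1 ∧ k.1 = r.size) ↔ l.1 < r.size :=
          fun l => ⟨by rintro ⟨k, h, h'⟩; omega, fun h => ⟨⟨_, hsize⟩, h, rfl⟩⟩
        simp only [rankGate, mkGate_factor]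
        simp [mkGate, restrict, indexBits, hex]
        refine Finset.prod_congr rfl fun l _ => ?_
        split_ifs with h
        · rfl
        -- Digits of `r` beyond its size are zero, so the identity contributes 1.
        · rw [Nat.testBit_lt_two_pow (Nat.size_le.1 (not_lt.1 h))]
          simp
      · congr 1
        funext i
        rcases i with _ | _ | _ | _ <;> simp [rankGate, mkGate, indexBits]
    · revert hi
      rcases i with _ | _ | _ | _ <;> simp [rankGate, mkGate]
  have e3 : ψ₃ (Sum.elim z (indexBits n r)) = ψ₂ (Sum.elim (fun _ => false) (indexBits n r)) := by
    rw [hψ₃, Gate.mulVec_of_isZeroAt _ _ fun i hi => h2 i ?_ ?_]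
    · have : (fun i => if i ∈ (dataGate f).target then false else
          (Sum.elim z (indexBits n r) : Register n → Bool) i) =
          Sum.elim (fun _ => false) (indexBits n r) := by
        funext i
        rcases i with _ | _ <;> simp [dataGate, mkGate]
      rw [this, Finset.prod_eq_one, one_mul]
      intro i hi
      rcases i with l | i
      · simp only [dataGate, mkGate_factor]
        simp [restrict, indexBits, hf, flipUnitary_apply]
      · simp [dataGate, mkGate] at hi
    · revert hi
      rcases i with _ | _ | _ | _ <;> simp [dataGate, mkGate]
    · revert hi
      rcases i with _ | _ | _ | _ <;> simp [dataGate, mkGate]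
  have e4 : ((flagGate V).toMatrix *ᵥ ψ₃) (Sum.elim z (indexBits n r)) =
      (V z : Matrix Bool Bool ℂ) false false * ψ₃ (Sum.elim z (indexBits n r)) := by
    have : (fun i => if i ∈ (flagGate V).target then false else
        (Sum.elim z (indexBits n r) : Register n → Bool) i) = Sum.elim z (indexBits n r) := by
      funext i
      rcases i with _ | _ | _ | _ <;> simp [flagGate, mkGate, indexBits]
    rw [Gate.mulVec_of_isZeroAt _ _ fun i hi => h3 i hi, this]
    simp only [flagGate, mkGate_factor]
    simp [mkGate, restrict, indexBits]
  rw [← e2, ← e3, ← e4,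
    -- The last gate XORs the index bits, so the amplitude at zero ancillas is the earlier one at
    -- those bits.
    Gate.mulVec_of_factor_eq_flip _ _ _ (Sum.elim (fun _ => false) (indexBits n r))]
  · congr 1
    funext i
    rcases i with _ | _ <;> simp
  · intro i
    simp only [indexGate, mkGate_factor]
    rcases i with _ | _ | _ | _ <;>
      simp [restrict, indexBits, flipUnitary_false, ← hr]

/-- Every vector can be prepared by a circuit with layout `blockLayout`, up to a constant
amplitude of the ancillas being zero. -/
lemma exists_block {n : ℕ} (X : (Fin n → Bool) → ℂ) (hX : ∑ z, ‖X z‖ ^ 2 = 1) (s : ℝ)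
    (hs0 : 0 ≤ s) (hs : 12 * s ^ 2 ≤ 1) :
    ∃ c, layout c = blockLayout n ∧
      ∀ z, run c (ket fun _ => false) (Sum.elim z fun _ => false) = s * X z := by
  obtain ⟨g, t, hg, hlt, ht, hts, hgt⟩ := exists_rank (n := n) (by simp)
    (fun z => ‖X z‖ ^ 2) (fun z => sq_nonneg _) hX
  have hbits : Function.Injective fun z => fun l : Fin n => (g z).testBit l := by
    intro z w h
    refine hg (Nat.eq_of_testBit_eq fun i => ?_)
    by_cases hi : i < n
    · exact congrFun h ⟨i, hi⟩
    · have hpow := Nat.pow_le_pow_right two_pos (not_lt.1 hi)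
      rw [Nat.testBit_lt_two_pow ((hlt z).trans_le hpow),
        Nat.testBit_lt_two_pow ((hlt w).trans_le hpow)]
  obtain ⟨f, hf⟩ := hbits.hasLeftInverse
  let a : ℕ → ℝ := fun k => Real.sqrt (t k / 4)
  let c : ℕ → ℝ := fun k => (Real.sqrt (1 + t k / 4))⁻¹
  have ha2 : ∀ k, a k ^ 2 = t k / 4 := fun k => Real.sq_sqrt (by linarith [ht k])
  have hc2 : ∀ k, c k ^ 2 = (1 + t k / 4)⁻¹ := fun k => by
    rw [inv_pow, Real.sq_sqrt (by linarith [ht k])]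
  have hT : ∀ k : Fin (n + 1), ∃ U : unitaryGroup Bool ℂ,
      (U : Matrix Bool Bool ℂ) false false = (c k : ℝ) ∧
      (U : Matrix Bool Bool ℂ) true false = (a k * c k : ℝ) := by
    intro k
    refine exists_unitary_column _ _ ?_
    rw [Complex.norm_real, Complex.norm_real, Real.norm_eq_abs, Real.norm_eq_abs, sq_abs, sq_abs,
      mul_pow, ha2, hc2]
    have : 1 + t k / 4 ≠ 0 := by linarith [ht k]
    rw [← one_add_mul, mul_inv_cancel₀ this]
  choose T hT0 hT1 using hT
  obtain ⟨H, hH0, hH1⟩ := exists_unitary_column (Real.sqrt 2⁻¹ : ℝ) (Real.sqrt 2⁻¹ : ℝ) (by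
    rw [Complex.norm_real, Real.norm_eq_abs, sq_abs, Real.sq_sqrt (by norm_num)]
    norm_num)
  -- The amplitude of each string of size `j` before the flag correction; `c k` normalizes `|0⟩ + a
  -- k |1⟩`.
  let β : ℕ → ℝ := fun j => Real.sqrt 2⁻¹ ^ j * (a j * ∏ k : Fin (n + 1), c k)
  have hβ0 : ∀ j, 0 ≤ β j := fun j => by
    refine mul_nonneg (by positivity) (mul_nonneg (Real.sqrt_nonneg _) ?_)
    exact Finset.prod_nonneg fun k _ => inv_nonneg.2 (Real.sqrt_nonneg _)
  have hprod : 3⁻¹ ≤ ∏ k : Fin (n + 1), c k ^ 2 := by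
    have h1 : ∏ k : Fin (n + 1), (1 + t k / 4) ≤ 3 := by
      refine (Real.prod_one_add_le_exp_sum _ fun k => by linarith [ht k]).trans ?_
      have h2 : ∑ k : Fin (n + 1), t k / 4 ≤ 1 := by
        rw [← Finset.sum_div, ← Finset.sum_range]
        linarith
      linarith [Real.exp_le_exp.2 h2, Real.exp_one_lt_d9]
    simp only [hc2, Finset.prod_inv_distrib]
    exact inv_anti₀ (Finset.prod_pos fun k _ => by linarith [ht k]) h1
  -- The constant 12 is `4 * 3`: 4 from the scaling of `t`, and 3 from `∏ (1 + t k / 4) ≤ exp 1 <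
  -- 3`.
  have hβ : ∀ z, s * ‖X z‖ ≤ β (g z).size := by
    intro z
    refine le_of_sq_le_sq ?_ (hβ0 _)
    have h1 : β (g z).size ^ 2 = (2 ^ (g z).size)⁻¹ *
        (t (g z).size / 4 * ∏ k : Fin (n + 1), c k ^ 2) := by
      simp only [β]
      rw [mul_pow, mul_pow, ha2, ← Finset.prod_pow, ← pow_mul, mul_comm _ 2, pow_mul,
        Real.sq_sqrt (by norm_num), inv_pow]
    have h2 := hgt z
    have h3 : ‖X z‖ ^ 2 ≤ (2 ^ (g z).size)⁻¹ * t (g z).size := by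
      rw [inv_mul_eq_div, le_div_iff₀ (by positivity)]
      linarith
    have h4 : 0 ≤ (2 ^ (g z).size : ℝ)⁻¹ * t (g z).size := mul_nonneg (by positivity) (ht _)
    rw [h1, mul_pow]
    nlinarith [mul_le_mul_of_nonneg_left hprod h4, mul_le_mul_of_nonneg_right hs (sq_nonneg ‖X z‖)]
  have hV : ∀ z, ∃ U : unitaryGroup Bool ℂ,
      (U : Matrix Bool Bool ℂ) false false = s * X z / (β (g z).size : ℝ) := by
    intro z
    refine exists_unitary_corner _ ?_
    rw [norm_div, norm_mul, Complex.norm_real, Complex.norm_real, Real.norm_of_nonneg hs0,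
      Real.norm_of_nonneg (hβ0 _)]
    exact div_le_one_of_le₀ (hβ z) (hβ0 _)
  choose V hV using hV
  refine ⟨[sizeGate T, rankGate n H, dataGate f, flagGate V,
    indexGate fun z => indexBits n (g z)], rfl, fun z => ?_⟩
  have hsize : (g z).size ≤ n := Nat.size_le.2 (hlt z)
  have hHb : ∀ b, (H : Matrix Bool Bool ℂ) b false = (Real.sqrt 2⁻¹ : ℝ) := by
    rintro (_ | _) <;> assumption
  have hTb : ∀ k : Fin (n + 1), (T k : Matrix Bool Bool ℂ) (decide (k.1 = (g z).size)) false =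
      (if k = ⟨(g z).size, Nat.lt_succ_of_le hsize⟩ then (a k : ℂ) else 1) * (c k : ℝ) := by
    intro k
    by_cases h : k.1 = (g z).size
    · simp [h, hT1, Fin.ext_iff]
    · simp [h, hT0, Fin.ext_iff]
  have hcard : ∏ l : Fin n, (if l.1 < (g z).size then ((Real.sqrt 2⁻¹ : ℝ) : ℂ) else 1) =
      ((Real.sqrt 2⁻¹ : ℝ) : ℂ) ^ (g z).size := by
    rw [Finset.prod_ite, Finset.prod_const_one, mul_one, Finset.prod_const, Fin.card_filter_val_lt,
      min_eq_right hsize]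
  rw [run_block T H f V g z (hlt z) (hf z), hV]
  simp only [hHb, hTb, Finset.prod_mul_distrib, hcard]
  rw [Finset.prod_ite_eq' Finset.univ]
  rw [if_pos (Finset.mem_univ _)]
  have : ((Real.sqrt 2⁻¹ : ℝ) : ℂ) ^ (g z).size *
      ((a (g z).size : ℂ) * ∏ k : Fin (n + 1), (c k : ℂ)) = (β (g z).size : ℝ) := by
    simp only [β]
    push_cast
    rfl
  rw [this]
  -- If `β` vanishes, the domination `hβ` forces `s * X z = 0` as well.
  refine div_mul_cancel_of_imp fun h => ?_
  have h0 := hβ z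
  rw [Complex.ofReal_eq_zero.1 h] at h0
  rw [← norm_eq_zero, norm_mul, Complex.norm_real, Real.norm_of_nonneg hs0]
  exact le_antisymm h0 (by positivity)

/-! ### Renaming of qubits. -/

section Relabel

variable {W W' : Type}

/-- Rename the qubits of a gate. -/
def Gate.relabel (e : W ≃ W') (g : Gate W) : Gate W' where
  address := g.address.map e.toEmbedding
  target := g.target.map e.toEmbedding
  disjoint := (Finset.disjoint_map _).2 g.disjoint
  table a b := g.table (fun i => a ⟨e i, Finset.mem_map_of_mem _ i.2⟩)
    ⟨e.symm b, Finset.mem_map_equiv.1 b.2⟩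

/-- Rename the qubits of a layout. -/
def relabelLayout (e : W ≃ W') (L : List (Finset W × Finset W)) : List (Finset W' × Finset W') :=
  L.map fun p => (p.1.map e.toEmbedding, p.2.map e.toEmbedding)

lemma layout_relabel (e : W ≃ W') (c : List (Gate W)) :
    layout (c.map (Gate.relabel e)) = relabelLayout e (layout c) := by
  simp [layout, relabelLayout, Gate.wires, Gate.relabel]

lemma time_relabelLayout (e : W ≃ W') (L : List (Finset W × Finset W)) :
    time (relabelLayout e L) = time L := by
  simp [time, relabelLayout, Function.comp_def]

variable [DecidableEq W] [Fintype W] [DecidableEq W'] [Fintype W']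

lemma Gate.relabel_toMatrix (e : W ≃ W') (g : Gate W) (z w : W' → Bool) :
    (g.relabel e).toMatrix z w = g.toMatrix (z ∘ e) (w ∘ e) := by
  rw [Gate.toMatrix_apply, Gate.toMatrix_apply, ← e.prod_comp]
  refine Finset.prod_congr rfl fun i _ => ?_
  have : (g.relabel e).factor z (e i) = g.factor (z ∘ e) i := by
    by_cases h : i ∈ g.target
    · have h' : e i ∈ (g.relabel e).target := Finset.mem_map_of_mem _ h
      rw [Gate.factor, Gate.factor, dif_pos h, dif_pos h']
      simp only [Gate.relabel, e.symm_apply_apply]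
      rfl
    · have h' : e i ∉ (g.relabel e).target := fun H => h (by
        simpa using Finset.mem_map_equiv.1 H)
      rw [Gate.factor, Gate.factor, dif_neg h, dif_neg h']
  rw [this]
  rfl

lemma run_relabel (e : W ≃ W') (c : List (Gate W)) (ψ : QState W) (z : W' → Bool) :
    run (c.map (Gate.relabel e)) (fun y => ψ (y ∘ e)) z = run c ψ (z ∘ e) := by
  induction c generalizing ψ with
  | nil => rfl
  | cons g c ih =>
    rw [List.map_cons, run_cons, run_cons, ← ih]
    congr 1
    funext y
    rw [Matrix.mulVec, dotProduct, Matrix.mulVec, dotProduct,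
      ← (e.symm.arrowCongr (Equiv.refl Bool)).sum_comp]
    exact Finset.sum_congr rfl fun w _ => by rw [g.relabel_toMatrix]; rfl

end Relabel

/-! ### Exact preparation and the running time. -/

/-- Exact preparation of a unit vector. -/
lemma exists_exact {n : ℕ} (q : Register n) (X : (Fin n → Bool) → ℂ)
    (hX : ∑ z, ‖X z‖ ^ 2 = 1) :
    ∃ c, layout c = amplifyLayout q (amplifyLayout q (blockLayout n)) ∧
      ∀ z, run c (ket fun _ => false) z =
        if ∀ a, z (Sum.inr a) = false then X (fun l => z (Sum.inl l)) else 0 := by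
  set s := Real.sin (Real.pi / 18) with hs
  have hs0 : 0 ≤ s := Real.sin_nonneg_of_nonneg_of_le_pi (by positivity)
    (by linarith [Real.pi_pos])
  have hs1 : 12 * s ^ 2 ≤ 1 := by
    have h1 : s ≤ Real.pi / 18 := Real.sin_le (by positivity)
    have h2 : s ≤ 1 / 4 := by linarith [Real.pi_lt_four]
    nlinarith
  have hs3 : (3 - 4 * s ^ 2) * s = 1 / 2 := by
    have := Real.sin_three_mul (Real.pi / 18)
    rw [show 3 * (Real.pi / 18) = Real.pi / 6 by ring, Real.sin_pi_div_six] at this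
    rw [this]
    ring
  obtain ⟨c, hc, hrun⟩ := exists_block X hX s hs0 hs1
  let P : (Register n → Bool) → Bool := fun z => decide (∀ a, z (Sum.inr a) = false)
  have hP : ∀ z, P z = true ↔ ∀ a, z (Sum.inr a) = false := fun z => decide_eq_true_iff
  have hPz : ∀ z, P z = true →
      Sum.elim (fun l => z (Sum.inl l)) (fun _ => false) = z := by
    intro z hz
    funext i
    rcases i with _ | a
    · rfl
    · exact ((hP z).1 hz a).symm
  have hsum : ∀ (ψ : QState (Register n)) (r : ℝ),
      (∀ z, ψ (Sum.elim z fun _ => false) = r * X z) → ∑ z with P z, ‖ψ z‖ ^ 2 = r ^ 2 := by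
    intro ψ r hψ
    have : ∑ z with P z, ‖ψ z‖ ^ 2 = ∑ z, (r ^ 2 * ‖X z‖ ^ 2) := by
      refine Finset.sum_nbij' (fun z l => z (Sum.inl l)) (fun z => Sum.elim z fun _ => false)
        ?_ ?_ ?_ ?_ ?_
      · simp
      · simp [hP]
      · intro z hz
        exact hPz z (by simpa using hz)
      · intro z _
        rfl
      · intro z hz
        conv_lhs => rw [← hPz z (by simpa using hz), hψ, norm_mul, Complex.norm_real, mul_pow,
          Real.norm_eq_abs, sq_abs]
    rw [this, ← Finset.mul_sum, hX, mul_one]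
  have h1 := run_amplify q P c s (hsum _ s hrun)
  have hrun1 : ∀ z, run (amplify q P c) (ket fun _ => false) (Sum.elim z fun _ => false) =
      ((1 / 2 : ℝ) : ℂ) * X z := by
    intro z
    rw [h1, if_pos ((hP _).2 fun _ => rfl), hrun, ← mul_assoc, ← hs3]
    push_cast
    rfl
  -- At amplitude `1 / 2` the good factor is 2 and the bad factor is 0, so the ancillas are exactly
  -- restored.
  have h2 := run_amplify q P (amplify q P c) (1 / 2) (hsum _ _ hrun1)
  refine ⟨amplify q P (amplify q P c), by rw [layout_amplify, layout_amplify, hc], fun z => ?_⟩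
  rw [h2]
  by_cases hz : P z = true
  · rw [if_pos hz, if_pos ((hP z).1 hz)]
    conv_lhs => rw [← hPz z hz]
    rw [hrun1]
    push_cast
    ring
  · rw [if_neg hz, if_neg fun H => hz ((hP z).2 H)]
    push_cast
    ring

/-- The state of a vector of length `m` can be prepared in time `O(log m)`, whatever the condition
number of the vector. -/
theorem exists_layout (m : ℕ) (hm : 2 ≤ m) :
    ∃ (k : ℕ) (L : List (Finset (Fin (Nat.clog 2 m) ⊕ Fin k) ×
        Finset (Fin (Nat.clog 2 m) ⊕ Fin k))),
      (time L : ℝ) ≤ 314 * Real.logb 2 m ∧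
      ∀ x : EuclideanSpace ℂ (Fin m), x ≠ 0 →
        ∃ c : List (Gate (Fin (Nat.clog 2 m) ⊕ Fin k)),
          layout c = L ∧ run c (ket fun _ => false) = vectorState x (Nat.clog 2 m) k := by
  set n := Nat.clog 2 m with hn
  have hn0 : 0 < n := Nat.clog_pos one_lt_two hm
  let e : Register n ≃ Fin n ⊕ Fin (Fintype.card (Ancilla n)) :=
    Equiv.sumCongr (Equiv.refl _) (Fintype.equivFin _)
  let q : Register n := Sum.inl ⟨0, hn0⟩
  refine ⟨_, relabelLayout e (amplifyLayout q (amplifyLayout q (blockLayout n))), ?_, ?_⟩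
  -- The time is `105 * n + 52`, and `n ≥ 1`; the final doubling to 314 comes from `n ≤ log₂ m + 1 ≤
  -- 2 * log₂ m`.
  · have h1 : (time (relabelLayout e (amplifyLayout q (amplifyLayout q (blockLayout n)))) : ℝ) ≤
        157 * n := by
      rw [time_relabelLayout, time_amplifyLayout, time_amplifyLayout, time_blockLayout]
      simp only [Fintype.card_sum, Fintype.card_fin, Fintype.card_unit]
      norm_cast
      omega
    have hm1 : (1 : ℝ) ≤ Real.logb 2 m := by
      rw [Real.le_logb_iff_rpow_le one_lt_two (by positivity), Real.rpow_one]
      exact_mod_cast hm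
    have hn1 : (n : ℝ) - 1 ≤ Real.logb 2 m := by
      rw [Real.le_logb_iff_rpow_le one_lt_two (by positivity), ← Nat.cast_pred hn0,
        Real.rpow_natCast]
      exact_mod_cast (Nat.pow_pred_clog_lt_self one_lt_two hm).le
    linarith
  · intro x hx
    let b : Fin m → Fin n → Bool := fun i l => i.1.testBit l
    have hb : Function.Injective b := by
      intro i j h
      refine Fin.ext (Nat.eq_of_testBit_eq fun l => ?_)
      have hmn : m ≤ 2 ^ n := Nat.le_pow_clog one_lt_two m
      by_cases hl : l < n
      · exact congrFun h ⟨l, hl⟩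
      · have hpow := Nat.pow_le_pow_right two_pos (not_lt.1 hl)
        rw [Nat.testBit_lt_two_pow ((i.2.trans_le hmn).trans_le hpow),
          Nat.testBit_lt_two_pow ((j.2.trans_le hmn).trans_le hpow)]
    -- By injectivity of `b` at most one term survives; strings that encode no index below `m` get
    -- amplitude 0.
    let X : (Fin n → Bool) → ℂ := fun z => ∑ i, if z = b i then x i / (‖x‖ : ℂ) else 0
    have hXsq : ∀ z, ‖X z‖ ^ 2 = ∑ i, if z = b i then ‖x i‖ ^ 2 / ‖x‖ ^ 2 else 0 := by
      intro z
      by_cases h : ∃ i, z = b i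
      · obtain ⟨i, rfl⟩ := h
        simp [X, hb.eq_iff, div_pow]
      · have h' : ∀ i, z ≠ b i := fun i hi => h ⟨i, hi⟩
        simp [X, h']
    have hX : ∑ z, ‖X z‖ ^ 2 = 1 := by
      simp only [hXsq]
      rw [Finset.sum_comm]
      simp only [Finset.sum_ite_eq', Finset.mem_univ, if_true]
      rw [← Finset.sum_div, ← EuclideanSpace.norm_sq_eq]
      exact div_self (pow_ne_zero _ (norm_ne_zero_iff.2 hx))
    obtain ⟨c, hc, hrun⟩ := exists_exact q X hX
    refine ⟨c.map (Gate.relabel e), by rw [layout_relabel, hc], ?_⟩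
    funext z
    have hket : (ket fun _ => false : QState (Fin n ⊕ Fin (Fintype.card (Ancilla n)))) =
        fun y => ket (fun _ => false) (y ∘ e) := by
      funext y
      simp only [ket, Pi.single_apply]
      congr 1
      rw [eq_iff_iff]
      refine ⟨fun h => by rw [h]; rfl, fun h => ?_⟩
      funext i
      simpa using congrFun h (e.symm i)
    rw [hket, run_relabel, hrun, vectorState, Finset.sum_apply]
    have henc : ∀ i : Fin m, z = encode n (Fintype.card (Ancilla n)) i ↔
        (∀ a, (z ∘ e) (Sum.inr a) = false) ∧ (fun l => (z ∘ e) (Sum.inl l)) = b i := by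
      intro i
      constructor
      · rintro rfl
        exact ⟨fun a => rfl, rfl⟩
      · rintro ⟨h1, h2⟩
        funext j
        rcases j with l | a
        · exact congrFun h2 l
        · change z (Sum.inr a) = false
          have := h1 ((Fintype.equivFin _).symm a)
          simpa only [e, Function.comp_apply, Equiv.sumCongr_apply, Sum.map_inr,
            Equiv.apply_symm_apply] using this
    simp only [Pi.smul_apply, ket, Pi.single_apply, henc, smul_eq_mul]
    split_ifs with h
    · simp only [X, h, implies_true, true_and, mul_ite, mul_one, mul_zero]
    · simp only [h, false_and, if_false, mul_zero, Finset.sum_const_zero]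

end StatePrep

theorem mainTheorem1 :
    ∃ C : ℝ, 0 < C ∧
      ∀ m : ℕ, 2 ≤ m → ∀ K : ℝ, 1 ≤ K →
        ∃ (k : ℕ) (L : List (Finset (Fin (Nat.clog 2 m) ⊕ Fin k) ×
            Finset (Fin (Nat.clog 2 m) ⊕ Fin k))),
          (StatePrep.time L : ℝ) ≤ C * Real.sqrt (1 + Real.logb 2 K) * Real.logb 2 m ∧
          ∀ x : EuclideanSpace ℂ (Fin m), x ≠ 0 → StatePrep.kappa x ≤ K →
            ∃ c : List (StatePrep.Gate (Fin (Nat.clog 2 m) ⊕ Fin k)),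
              StatePrep.layout c = L ∧
              StatePrep.run c (StatePrep.ket fun _ => false) =
                StatePrep.vectorState x (Nat.clog 2 m) k := by
  refine ⟨314, by norm_num, fun m hm K hK => ?_⟩
  obtain ⟨k, L, hL, h⟩ := StatePrep.exists_layout m hm
  refine ⟨k, L, hL.trans ?_, fun x hx _ => h x hx⟩
  have hs : 1 ≤ Real.sqrt (1 + Real.logb 2 K) := by
    rw [Real.one_le_sqrt]
    linarith [Real.logb_nonneg one_lt_two hK]
  have hm0 : 0 ≤ Real.logb 2 m :=
    Real.logb_nonneg one_lt_two (by exact_mod_cast one_le_two.trans hm)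
  exact mul_le_mul_of_nonneg_right (le_mul_of_one_le_right (by norm_num) hs) hm0

end
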